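/- Let $\mathcal A=(\mathcal A,\preccurlyeq,\to,\mathcal S)$ be an implicative algebra, i.e. a complete lattice $(\mathcal A,\preccurlyeq)$ with a binary operation $\to$ that is antitone in its first argument, monotone in its second, and satisfies $a\to\bigwedge B=\bigwedge_{b\in B}(a\to b)$ for all $a\in\mathcal A$, $B\subseteq\mathcal A$, together with a separator: an upward closed subset $\mathcal S\subseteq\mathcal A$ that is closed under modus ponens ($a\to b\in\mathcal S$ and $a\in\mathcal S$ imply $b\in\mathcal S$) and contains the interpretations $\mathbf K^{\mathcal A}$, $\mathbf S^{\mathcal A}$ of the $\lambda$-terms $\lambda xy.\,x$ and $\lambda xyz.\,xz(yz)$, where application is $ab:=\bigwedge\{c: a\preccurlyeq(b\to c)\}$ and the abstraction of $f:\mathcal A\to\mathcal A$ is $\bigwedge_{a}(a\to f(a))$. Let $\mathbf{Asm}_{\mathcal A}$ be the category of assemblies: objects are pairs $X=(|X|,\mathsf E_X)$ of a set $|X|$ and a function $\mathsf E_X:|X|\to\mathcal S$; morphisms $X\to Y$ are the functions $f:|X|\to|Y|$ such that $\bigwedge_{x\in|X|}\bigl(\mathsf E_X(x)\to\mathsf E_Y(f(x))\bigr)\in\mathcal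 S$. Let $\Gamma:\mathbf{Asm}_{\mathcal A}\to\mathbf{Set}$ be the forgetful functor $X\mapsto|X|$, and $\Delta:\mathbf{Set}\to\mathbf{Asm}_{\mathcal A}$ its right adjoint, which sends a set $X$ to $X$ with the constant existence predicate $\top$, both functors acting as the identity on underlying functions. Let $\mathbf P:\mathbf{Set}^{\mathrm{op}}\to\mathbf{HA}$ be the tripos induced by $\mathcal A$: it sends a set $I$ to the Heyting algebra obtained from $\mathcal A^I$ with the preorder $\varphi\vdash\psi$ iff $\bigwedge_{i\in I}(\varphi(i)\to\psi(i))\in\mathcal S$ by identifying predicates that entail each other, and a function to reindexing along it. A forcing tripos is a functor $\mathrm{Hom}_{\mathbf{Set}}(-,H):\mathbf{Set}^{\mathrm{op}}\to\mathbf{HA}$ for a complete Heyting algebra $H$, with the pointwise structure on $\mathrm{Hom}_{\mathbf{Set}}(I,H)$. Then the following are equivalent: 1. the category $\mathbf{Asm}_{\mathcal A}$ is balanced (every morphism that is both mono and epi is an isomorphism); 2. $\mathbf{Asm}_{\mathcal A}$ is an elementary topos; 3. $\mathbf{Asm}_{\mathcal A}$ is a Grothendieck topos, i.e. equivalent to the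 category of sheaves of sets on a small site; 4. the functor $\Gamma:\mathbf{Asm}_{\mathcal A}\to\mathbf{Set}$ is full; 5. the adjunction $\Gamma\dashv\Delta$ is an equivalence of categories between $\mathbf{Asm}_{\mathcal A}$ and $\mathbf{Set}$, i.e. its unit and counit are isomorphisms; 6. the tripos $\mathbf P$ is isomorphic to a forcing tripos, i.e. there are a complete Heyting algebra $H$ and a natural isomorphism $\mathbf P\cong\mathrm{Hom}_{\mathbf{Set}}(-,H)$ of functors $\mathbf{Set}^{\mathrm{op}}\to\mathbf{HA}$. -/

import Mathlib

open CategoryTheory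

universe v u

/-- An implicative structure: a complete lattice with an implication that is antitone in its first
argument, monotone in its second, and commutes with arbitrary meets (the empty one included) in
its second argument. -/
class ImplicativeStructure (A : Type u) extends CompleteLattice A where
  /-- the implication `a → b` -/
  imp : A → A → A
  imp_mono : ∀ {a a' b b' : A}, a' ≤ a → b ≤ b' → imp a b ≤ imp a' b'
  imp_sInf : ∀ (a : A) (B : Set A), imp a (sInf B) = ⨅ b ∈ B, imp a b

namespace ImplicativeStructure

variable {A : Type u} [ImplicativeStructure A]

/-- Application `ab = ⋀ {c | a ≤ (b → c)}`. -/
def app (a b : A) : A := sInf {c | a ≤ imp b c}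

/-- Abstraction `⋀ a, (a → f a)`. -/
def lam (f : A → A) : A := ⨅ a, imp a (f a)

variable (A) in
/-- The interpretation of the term `λ x y, x`. -/
def combK : A := lam fun x => lam fun _ => x

variable (A) in
/-- The interpretation of the term `λ x y z, x z (y z)`. -/
def combS : A := lam fun x => lam fun y => lam fun z => app (app x z) (app y z)

/-- Conjunction (second-order encoding). -/
def conj (a b : A) : A := ⨅ c : A, imp (imp a (imp b c)) c

/-- Disjunction (second-order encoding). -/
def disj (a b : A) : A := ⨅ c : A, imp (imp a c) (imp (imp b c) c)

theorem imp_iInf {ι : Sort v} (a : A) (f : ι → A) : imp a (⨅ i, f i) = ⨅ i, imp a (f i) := by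
  rw [iInf, imp_sInf, iInf_range]

theorem le_imp_app (a b : A) : a ≤ imp b (app a b) := by
  rw [app, imp_sInf]
  exact le_iInf₂ fun c hc => hc

theorem app_le {a b c : A} (h : a ≤ imp b c) : app a b ≤ c := sInf_le h

theorem combK_le (a b : A) : combK A ≤ imp a (imp b a) :=
  (iInf_le _ a).trans (imp_mono le_rfl (iInf_le _ b))

theorem combS_le (a b c : A) :
    combS A ≤ imp (imp a (imp b c)) (imp (imp a b) (imp a c)) := by
  refine (iInf_le _ (imp a (imp b c))).trans (imp_mono le_rfl ?_)
  refine (iInf_le _ (imp a b)).trans (imp_mono le_rfl ?_)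
  refine (iInf_le _ a).trans (imp_mono le_rfl ?_)
  exact app_le ((app_le le_rfl).trans (imp_mono (app_le le_rfl) le_rfl))

end ImplicativeStructure

open ImplicativeStructure in
/-- An implicative algebra: an implicative structure with a separator, i.e. an upward closed set
that contains `K` and `S` and is closed under modus ponens. -/
class ImplicativeAlgebra (A : Type u) extends ImplicativeStructure A where
  /-- the separator -/
  sep : Set A
  sep_upward : ∀ {a b : A}, a ∈ sep → a ≤ b → b ∈ sep
  combK_mem : combK A ∈ sep
  combS_mem : combS A ∈ sep
  modus_ponens : ∀ {a b : A}, imp a b ∈ sep → a ∈ sep → b ∈ sep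

namespace ImplicativeAlgebra

open ImplicativeStructure

variable {A : Type u} [ImplicativeAlgebra A]

section Realizers

/-- A family of truth values is realized when its meet is in the separator. -/
def Realized {I : Type v} (φ : I → A) : Prop := (⨅ i, φ i) ∈ (sep : Set A)

variable {I : Type v} {α β γ δ : I → A}

theorem Realized.of_mem {s : A} (hs : s ∈ (sep : Set A)) (h : ∀ i, s ≤ α i) : Realized α :=
  sep_upward hs (le_iInf h)

theorem app_mem {s t : A} (hs : s ∈ (sep : Set A)) (ht : t ∈ (sep : Set A)) :
    app s t ∈ (sep : Set A) :=
  modus_ponens (sep_upward hs (le_imp_app s t)) ht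

theorem Realized.mp (h : Realized fun i => imp (α i) (β i)) (h' : Realized α) : Realized β :=
  .of_mem (app_mem h h') fun i =>
    app_le ((iInf_le _ i).trans (imp_mono (iInf_le _ i) le_rfl))

theorem Realized.k : Realized fun i => imp (α i) (imp (β i) (α i)) :=
  .of_mem combK_mem fun _ => combK_le _ _

theorem Realized.s : Realized fun i =>
    imp (imp (α i) (imp (β i) (γ i))) (imp (imp (α i) (β i)) (imp (α i) (γ i))) :=
  .of_mem combS_mem fun _ => combS_le _ _ _

theorem Realized.const (h : Realized α) : Realized fun i => imp (β i) (α i) := k.mp h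

theorem Realized.ap (h : Realized fun i => imp (α i) (imp (β i) (γ i)))
    (h' : Realized fun i => imp (α i) (β i)) : Realized fun i => imp (α i) (γ i) :=
  (s.mp h).mp h'

theorem Realized.id : Realized fun i => imp (α i) (α i) :=
  ap (β := fun i => imp (α i) (α i)) k k

theorem Realized.trans (h : Realized fun i => imp (α i) (β i))
    (h' : Realized fun i => imp (β i) (γ i)) : Realized fun i => imp (α i) (γ i) :=
  h'.const.ap h

theorem Realized.flip (h : Realized fun i => imp (α i) (imp (β i) (γ i))) :
    Realized fun i => imp (β i) (imp (α i) (γ i)) :=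
  k.trans (s.mp h)

theorem Realized.under (h : Realized fun i => imp (β i) (γ i)) :
    Realized fun i => imp (imp (α i) (β i)) (imp (α i) (γ i)) :=
  s.mp h.const

theorem Realized.pre (h : Realized fun i => imp (α i) (β i)) :
    Realized fun i => imp (imp (β i) (γ i)) (imp (α i) (γ i)) :=
  (h.trans Realized.id.flip).flip

theorem Realized.c : Realized fun i =>
    imp (imp (α i) (imp (β i) (γ i))) (imp (β i) (imp (α i) (γ i))) :=
  s.trans (pre k)

theorem Realized.imp_iInf_iff {J : Type u} {χ : I → J → A} :
    (Realized fun i => imp (α i) (⨅ j, χ i j)) ↔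
      Realized fun p : I × J => imp (α p.1) (χ p.1 p.2) := by
  simp only [Realized, imp_iInf, iInf_prod]

theorem Realized.lift {J : Type u} (h : Realized α) : Realized fun p : I × J => α p.1 :=
  .of_mem h fun p => iInf_le _ p.1

theorem Realized.of_le (h : ∀ i, α i ≤ β i) : Realized fun i => imp (α i) (β i) :=
  .of_mem (s := ⨅ a : A, imp a a) (Realized.id (α := fun a : A => a))
    fun i => (iInf_le _ (α i)).trans (imp_mono le_rfl (h i))

theorem Realized.conj_left : Realized fun i => imp (conj (α i) (β i)) (α i) :=
  Realized.trans (β := fun i => imp (imp (α i) (imp (β i) (α i))) (α i))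
    (of_le fun i => iInf_le _ (α i)) (Realized.id.flip.mp k)

theorem Realized.conj_right : Realized fun i => imp (conj (α i) (β i)) (β i) :=
  Realized.trans (β := fun i => imp (imp (α i) (imp (β i) (β i))) (β i))
    (of_le fun i => iInf_le _ (β i)) (Realized.id.flip.mp Realized.id.const)

theorem Realized.conj_intro : Realized fun i => imp (α i) (imp (β i) (conj (α i) (β i))) := by
  have h : Realized fun p : I × A =>
      imp (α p.1) (imp (β p.1) (imp (imp (α p.1) (imp (β p.1) p.2)) p.2)) :=
    (Realized.id (α := fun p : I × A => imp (α p.1) (imp (β p.1) p.2))).flip.trans c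
  simpa only [Realized, conj, imp_iInf, iInf_prod] using h

theorem Realized.le_conj (h : Realized fun i => imp (α i) (β i))
    (h' : Realized fun i => imp (α i) (γ i)) :
    Realized fun i => imp (α i) (conj (β i) (γ i)) :=
  (h.trans conj_intro).ap h'

theorem Realized.disj_left : Realized fun i => imp (α i) (disj (α i) (β i)) := by
  refine imp_iInf_iff.2 ?_
  exact (Realized.id.flip (γ := fun p : I × A => p.2)).trans (under k)

theorem Realized.disj_right : Realized fun i => imp (β i) (disj (α i) (β i)) := by
  refine imp_iInf_iff.2 ?_
  exact (Realized.id.flip (γ := fun p : I × A => p.2)).trans k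

theorem Realized.disj_le (h : Realized fun i => imp (α i) (γ i))
    (h' : Realized fun i => imp (β i) (γ i)) :
    Realized fun i => imp (disj (α i) (β i)) (γ i) :=
  Realized.ap (Realized.ap (of_le fun i => iInf_le _ (γ i)) h.const) h'.const

end Realizers

/-- The set `A ^ I` of predicates on `I` (to be preordered by entailment, not pointwise). -/
def Pred (A : Type u) (I : Type v) : Type max u v := I → A

/-- Entailment: `φ ⊢ ψ` iff `⋀ i, (φ i → ψ i)` is in the separator. -/
instance Pred.instPreorder (I : Type v) : Preorder (Pred A I) where
  le φ ψ := (⨅ i, imp (φ i) (ψ i)) ∈ (sep : Set A)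
  le_refl _ := Realized.id
  le_trans _ _ _ h h' := Realized.trans h h'

variable (A) in
/-- The Heyting algebra induced by `A ^ I` preordered by entailment: predicates up to
interentailment. -/
abbrev PredQuot (I : Type v) : Type max u v := Antisymmetrization (Pred A I) (· ≤ ·)

/-- The order is induced by entailment, the connectives are computed pointwise on
representatives. -/
instance PredQuot.instHeytingAlgebra (I : Type v) : HeytingAlgebra (PredQuot A I) where
  inf := Quotient.map₂ (fun φ ψ i => conj (φ i) (ψ i)) fun _ _ h _ _ h' =>
    ⟨Realized.le_conj (Realized.conj_left.trans h.1) (Realized.conj_right.trans h'.1),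
      Realized.le_conj (Realized.conj_left.trans h.2) (Realized.conj_right.trans h'.2)⟩
  sup := Quotient.map₂ (fun φ ψ i => disj (φ i) (ψ i)) fun _ _ h _ _ h' =>
    ⟨Realized.disj_le (Realized.trans h.1 Realized.disj_left)
        (Realized.trans h'.1 Realized.disj_right),
      Realized.disj_le (Realized.trans h.2 Realized.disj_left)
        (Realized.trans h'.2 Realized.disj_right)⟩
  himp := Quotient.map₂ (fun φ ψ i => imp (φ i) (ψ i)) fun _ _ h _ _ h' =>
    ⟨(Realized.pre h.2).trans (Realized.under h'.1),
      (Realized.pre h.1).trans (Realized.under h'.2)⟩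
  compl := Quotient.map (fun φ i => imp (φ i) ⊥) fun _ _ h =>
    ⟨Realized.pre h.2, Realized.pre h.1⟩
  top := toAntisymmetrization (α := Pred A I) (· ≤ ·) fun _ => ⊤
  bot := toAntisymmetrization (α := Pred A I) (· ≤ ·) fun _ => ⊥
  le_top a := Quotient.inductionOn a fun _ => Realized.of_le fun _ => le_top
  bot_le a := Quotient.inductionOn a fun _ => Realized.of_le fun _ => bot_le
  inf_le_left a b := Quotient.inductionOn₂ a b fun _ _ => Realized.conj_left
  inf_le_right a b := Quotient.inductionOn₂ a b fun _ _ => Realized.conj_right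
  le_inf a b c := Quotient.inductionOn₃ a b c fun _ _ _ h h' => Realized.le_conj h h'
  le_sup_left a b := Quotient.inductionOn₂ a b fun _ _ => Realized.disj_left
  le_sup_right a b := Quotient.inductionOn₂ a b fun _ _ => Realized.disj_right
  sup_le a b c := Quotient.inductionOn₃ a b c fun _ _ _ h h' => Realized.disj_le h h'
  le_himp_iff a b c := Quotient.inductionOn₃ a b c fun _ _ _ =>
    ⟨fun h => (Realized.trans Realized.conj_left h).ap Realized.conj_right,
      fun h => Realized.conj_intro.trans (Realized.under h)⟩
  himp_bot a := Quotient.inductionOn a fun _ => rfl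

/-- Reindexing of predicates along `f : I → J`. -/
def PredQuot.reindex {I J : Type v} (f : I → J) : HeytingHom (PredQuot A J) (PredQuot A I) where
  toFun := Quotient.map (fun φ i => φ (f i)) fun _ _ h =>
    ⟨Realized.of_mem h.1 fun i => iInf_le _ (f i), Realized.of_mem h.2 fun i => iInf_le _ (f i)⟩
  map_sup' a b := Quotient.inductionOn₂ a b fun _ _ => rfl
  map_inf' a b := Quotient.inductionOn₂ a b fun _ _ => rfl
  map_bot' := rfl
  map_himp' a b := Quotient.inductionOn₂ a b fun _ _ => rfl

variable (A) in
/-- The tripos `Setᵒᵖ ⥤ HA` induced by `A`: it maps `I` to the Heyting algebra `A ^ I / sep[I]`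
and acts on maps by reindexing. -/
def tripos : (Type u)ᵒᵖ ⥤ HeytAlg.{u} where
  obj I := HeytAlg.of (PredQuot A I.unop)
  map f := HeytAlg.ofHom (PredQuot.reindex fun x => f.unop x)
  map_id _ := HeytAlg.ext fun a => Quotient.inductionOn a fun _ => rfl
  map_comp _ _ := HeytAlg.ext fun a => Quotient.inductionOn a fun _ => rfl

/-- Precomposition with `f : I → J` on `H`-valued functions. -/
def precompHeytingHom (H : Type u) [HeytingAlgebra H] {I J : Type v} (f : I → J) :
    HeytingHom (J → H) (I → H) where
  toFun φ i := φ (f i)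
  map_sup' _ _ := rfl
  map_inf' _ _ := rfl
  map_bot' := rfl
  map_himp' _ _ := rfl

/-- The forcing tripos `Hom(-, H) : Setᵒᵖ ⥤ HA` of a complete Heyting algebra `H`
(with the pointwise structure on `I → H`). -/
def forcingTripos (H : Type u) [Order.Frame H] : (Type u)ᵒᵖ ⥤ HeytAlg.{u} where
  obj I := HeytAlg.of (I.unop → H)
  map f := HeytAlg.ofHom (precompHeytingHom H fun x => f.unop x)

variable (A) in
/-- The tripos induced by `A` is isomorphic to a forcing tripos. -/
def IsForcing : Prop :=
  ∃ (H : Type u) (_ : Order.Frame H), Nonempty (tripos A ≅ forcingTripos H)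

/-- An assembly on `A`: a set with an existence predicate valued in the separator. -/
structure Assembly (A : Type u) [ImplicativeAlgebra A] where
  /-- the underlying set -/
  carrier : Type u
  /-- the existence predicate -/
  ex : carrier → (sep : Set A)

namespace Assembly

/-- A morphism of assemblies: a function that satisfies the tracking condition. -/
@[ext]
structure Hom (X Y : Assembly A) where
  /-- the underlying function -/
  toFun : X.carrier → Y.carrier
  tracked : (⨅ x, imp (X.ex x : A) (Y.ex (toFun x) : A)) ∈ (sep : Set A)

instance instCategory : Category (Assembly A) where
  Hom := Hom
  id X := ⟨fun x => x, Realized.id⟩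
  comp {X Y Z} f g := ⟨fun x => g.toFun (f.toFun x),
    Realized.trans (β := fun x => (Y.ex (f.toFun x) : A)) f.tracked
      (Realized.of_mem g.tracked fun x => iInf_le _ (f.toFun x))⟩

theorem top_mem : (⊤ : A) ∈ (sep : Set A) := sep_upward combK_mem le_top

variable (A) in
/-- The forgetful functor `Γ`. -/
def forgetful : Assembly A ⥤ Type u where
  obj X := X.carrier
  map f := TypeCat.ofHom (Hom.toFun f)

/-- The tracking condition for functions into a constant assembly. -/
theorem tracked_top {I : Type v} (φ : I → A) :
    (⨅ i, imp (φ i) (⊤ : A)) ∈ (sep : Set A) :=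
  Realized.of_le fun _ => le_top

variable (A) in
/-- The functor `Δ`, equipping a set with the constant existence predicate `⊤`. -/
def constant : Type u ⥤ Assembly A where
  obj X := ⟨X, fun _ => ⟨⊤, top_mem⟩⟩
  map f := ⟨fun x => f x, tracked_top _⟩

variable (A) in
/-- The adjunction `Γ ⊣ Δ`; both transposes leave the underlying function unchanged. -/
def adj : forgetful A ⊣ constant A :=
  Adjunction.mkOfHomEquiv
    { homEquiv := fun _ _ =>
        { toFun := fun f => ⟨fun x => f x, tracked_top _⟩
          invFun := fun g => TypeCat.ofHom (Hom.toFun g)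
          left_inv := fun _ => rfl
          right_inv := fun _ => rfl }
      homEquiv_naturality_left_symm := fun _ _ => rfl
      homEquiv_naturality_right := fun _ _ => rfl }

end Assembly

end ImplicativeAlgebra

/-- An elementary topos: finite limits, exponentials (with respect to the cartesian product) and a
subobject classifier. -/
structure IsElementaryTopos (C : Type u) [Category.{v} C] : Prop where
  hasFiniteLimits : Limits.HasFiniteLimits C
  cartesianClosed : ∃ _ : CartesianMonoidalCategory C, Nonempty (MonoidalClosed C)
  hasSubobjectClassifier : HasSubobjectClassifier C

/-- A Grothendieck topos: a category equivalent to the category of sheaves of sets on some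
small site. -/
def IsGrothendieckTopos (C : Type u) [Category.{v} C] : Prop :=
  ∃ (D : Type v) (_ : SmallCategory D) (J : GrothendieckTopology D),
    Nonempty (C ≌ Sheaf J (Type v))

/-! Everything reduces to one condition: the separator is principal, i.e. contains its own meet. In
that case a family of truth values is realized as soon as each member lies in `sep`. Hence every
function between assemblies is tracked, and entailment is pointwise, so that predicates on `I`
amount to functions from `I` into the Heyting algebra of closed predicates, which is complete.

Conversely, consider the set `sep` with its inclusion into `A`: each value is true, and uniform
truth of this generic family forces principality. Fullness of `Γ` and a forcing presentation each
supply that uniformity (`principal_of_full_forgetful`, `principal_of_isForcing`).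

Fullness of `Γ` also makes assemblies equivalent to sets, hence a topos in either sense, hence
balanced; balancedness gives fullness back, since the unit of `Γ ⊣ Δ` is the identity on underlying
sets. -/

namespace ImplicativeAlgebra

open ImplicativeStructure

variable {A : Type u} [ImplicativeAlgebra A]

/-! ### Principal separators -/

section Principal

/-- A family of members of a principal separator is realized. -/
theorem realized_iff_of_principal (h : sInf (sep : Set A) ∈ (sep : Set A)) {I : Type v}
    {φ : I → A} : Realized φ ↔ ∀ i, φ i ∈ (sep : Set A) :=
  ⟨fun hφ i => sep_upward hφ (iInf_le φ i), fun hφ => .of_mem h fun i => sInf_le (hφ i)⟩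

/-- The separator is principal if the family of all its members is entailed by `⊤`. -/
theorem principal_of_realized
    (h : Realized fun s : (sep : Set A) => imp (⊤ : A) (s : A)) :
    sInf (sep : Set A) ∈ (sep : Set A) := by
  have h' : imp (⊤ : A) (sInf (sep : Set A)) ∈ (sep : Set A) := by
    rw [sInf_eq_iInf', imp_iInf]
    exact h
  exact modus_ponens h' Assembly.top_mem

end Principal

/-! ### Fullness of `Γ`, the unit, and balancedness -/

namespace Assembly

theorem full_forgetful_of_principal (h : sInf (sep : Set A) ∈ (sep : Set A)) :
    (forgetful A).Full where
  map_surjective {_ Y} f := ⟨⟨fun x => f x,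
    Realized.const (α := fun x => (Y.ex (f x) : A))
      ((realized_iff_of_principal h).2 fun x => (Y.ex (f x)).2)⟩, rfl⟩

theorem principal_of_full_forgetful [(forgetful A).Full] :
    sInf (sep : Set A) ∈ (sep : Set A) := by
  -- The generic assembly: a tracker of the identity from `Δ sep` to it realizes all members of
  -- `sep` uniformly.
  let Y : Assembly A := ⟨(sep : Set A), fun s => s⟩
  obtain ⟨g, hg⟩ := (forgetful A).map_surjective (X := (constant A).obj (sep : Set A)) (Y := Y)
    (TypeCat.ofHom fun s => s)
  have hg' : ∀ s, g.toFun s = s := fun s => ConcreteCategory.congr_hom hg s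
  refine principal_of_realized ?_
  have := g.tracked
  simp only [hg'] at this
  exact this

instance : (forgetful A).Faithful where
  map_injective h :=
    Hom.ext (funext fun x => ConcreteCategory.congr_hom h x)

instance : (constant A).Faithful where
  map_injective h := by
    ext x
    exact congrFun (congrArg Hom.toFun h) x

instance : (constant A).Full where
  map_surjective f := ⟨TypeCat.ofHom f.toFun, rfl⟩

instance (X : Assembly A) : Epi ((adj A).unit.app X) :=
  (forgetful A).epi_of_epi_map inferInstance

instance [(forgetful A).Full] : (forgetful A).IsEquivalence :=
  (adj A).toEquivalence.isEquivalence_functor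

/-- The unit components are mono and epi because the faithful `Γ` sends them to identities. Once
they are invertible, the left adjoint is full. -/
theorem full_forgetful_of_balanced [Balanced (Assembly A)] : (forgetful A).Full :=
  have : ∀ X, IsIso ((adj A).unit.app X) := fun _ => isIso_of_mono_of_epi _
  (adj A).full_L_of_isSplitEpi_unit_app

end Assembly

/-! ### Forcing triposes -/

section Forcing

open Assembly

/-- In a forcing tripos a predicate is `⊤` once its restriction to every point is. The isomorphism
carries this property to `tripos A`, where it applies to the generic predicate `φ`. -/
theorem principal_of_isForcing (h : IsForcing A) : sInf (sep : Set A) ∈ (sep : Set A) := by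
  obtain ⟨H, _, ⟨e⟩⟩ := h
  let φ : PredQuot A (sep : Set A) :=
    toAntisymmetrization (α := Pred A (sep : Set A)) (· ≤ ·) fun s => (s : A)
  have hφ : e.hom.app (.op (sep : Set A)) φ =
      (⊤ : (forcingTripos H).obj (.op (sep : Set A))) := by
    funext s
    let p : PUnit.{u + 1} ⟶ ((sep : Set A) : Type u) := TypeCat.ofHom fun _ => s
    have hn : e.hom.app (.op PUnit) ((tripos A).map p.op φ) =
        (forcingTripos H).map p.op (e.hom.app (.op (sep : Set A)) φ) :=
      ConcreteCategory.congr_hom (e.hom.naturality p.op) φ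
    -- Restricted to the point `s`, `φ` is the constant predicate with value `s ∈ sep`.
    have ht : (tripos A).map p.op φ = (⊤ : PredQuot A PUnit.{u + 1}) :=
      top_le_iff.1 (Realized.const (α := fun _ : PUnit.{u + 1} => (s : A))
        (Realized.of_mem s.2 fun _ => le_rfl))
    have hs := congrFun ((hn.symm.trans (congrArg _ ht)).trans
      (map_top (e.hom.app (.op PUnit)).hom)) PUnit.unit
    exact hs
  have hφ' : φ = ⊤ := by
    have hi : Function.Injective (e.hom.app (.op (sep : Set A))) :=
      (ConcreteCategory.bijective_of_isIso (e.hom.app (.op (sep : Set A)))).1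
    exact hi (hφ.trans (map_top (e.hom.app (.op (sep : Set A))).hom).symm)
  exact principal_of_realized (top_le_iff.2 hφ')

/-- The truth value in `A` representing an element of the Heyting algebra of closed predicates. -/
noncomputable def PredQuot.rep (a : PredQuot A PUnit.{u + 1}) : A := Quotient.out a PUnit.unit

/-- The class of a truth value. -/
def PredQuot.mk (a : A) : PredQuot A PUnit.{u + 1} :=
  toAntisymmetrization (α := Pred A PUnit.{u + 1}) (· ≤ ·) fun _ => a

theorem PredQuot.mk_rep (a : PredQuot A PUnit.{u + 1}) : mk (rep a) = a := Quotient.out_eq a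

theorem PredQuot.mk_le_mk {a b : A} : mk a ≤ mk b ↔ imp a b ∈ (sep : Set A) := by
  change (⨅ _ : PUnit.{u + 1}, imp a b) ∈ (sep : Set A) ↔ _
  rw [iInf_const]

/-- Meets of closed predicates, computed on representatives. -/
noncomputable instance PredQuot.instInfSet : InfSet (PredQuot A PUnit.{u + 1}) where
  sInf B := mk (⨅ b : B, rep b.1)

/-- Implication into a meet is a meet of implications; principality reduces its membership in `sep`
to that of each implication separately. -/
theorem PredQuot.isGLB_sInf (h : sInf (sep : Set A) ∈ (sep : Set A))
    (B : Set (PredQuot A PUnit.{u + 1})) : IsGLB B (sInf B) := by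
  constructor
  · intro b hb
    rw [← mk_rep b]
    exact mk_le_mk.2 (sep_upward (Realized.of_le (I := PUnit.{u + 1}) fun _ =>
      iInf_le (fun b : B => rep b.1) ⟨b, hb⟩) (iInf_le _ PUnit.unit))
  · intro a ha
    rw [← mk_rep a]
    refine mk_le_mk.2 ?_
    rw [imp_iInf]
    refine (realized_iff_of_principal h).2 fun b => mk_le_mk.1 ?_
    rw [mk_rep, mk_rep]
    exact ha b.2

/-- If the separator is principal, then the Heyting algebra of closed predicates is complete. -/
noncomputable abbrev PredQuot.frameOfPrincipal (h : sInf (sep : Set A) ∈ (sep : Set A)) :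
    Order.Frame (PredQuot A PUnit.{u + 1}) :=
  { PredQuot.instHeytingAlgebra (A := A) PUnit.{u + 1} with
    sInf := sInf
    sSup B := sInf (upperBounds B)
    isGLB_sInf B := isGLB_sInf h B
    isLUB_sSup B := isGLB_upperBounds.1 (isGLB_sInf h (upperBounds B)) }

/-- If the separator is principal, then entailment of predicates is pointwise. -/
noncomputable def PredQuot.orderIsoPi (h : sInf (sep : Set A) ∈ (sep : Set A)) (I : Type u) :
    PredQuot A I ≃o (I → PredQuot A PUnit.{u + 1}) :=
  RelIso.ofSurjective
    (OrderEmbedding.ofMapLEIff (fun φ i => reindex (fun _ : PUnit.{u + 1} => i) φ)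
      fun a b => Quotient.inductionOn₂ a b fun φ ψ =>
        (forall_congr' fun i => mk_le_mk (a := φ i) (b := ψ i)).trans
          (realized_iff_of_principal h).symm)
    -- Surjectivity: representatives chosen at each point assemble into one predicate.
    fun f => ⟨toAntisymmetrization (α := Pred A I) (· ≤ ·) fun i => rep (f i),
      funext fun i => mk_rep (f i)⟩

theorem isForcing_of_principal (h : sInf (sep : Set A) ∈ (sep : Set A)) : IsForcing A :=
  letI := PredQuot.frameOfPrincipal h
  ⟨PredQuot A PUnit.{u + 1}, PredQuot.frameOfPrincipal h,
    ⟨NatIso.ofComponents (fun I => HeytAlg.Iso.mk (PredQuot.orderIsoPi h I.unop))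
      fun _ => HeytAlg.ext fun a => Quotient.inductionOn a fun _ => rfl⟩⟩

end Forcing

end ImplicativeAlgebra

/-! ### Toposes: transport from sets, and balancedness -/

section Topos

open Limits

/-- Sheaves of types on a point are types. -/
noncomputable def sheafPointEquivalence :
    Sheaf (⊥ : GrothendieckTopology (Discrete PUnit.{u + 1})) (Type u) ≌ Type u :=
  (sheafBotEquivalence (Type u)).trans
    (((Discrete.opposite PUnit.{u + 1}).congrLeft).trans Functor.equiv)

theorem isElementaryTopos_of_equivalence {C : Type u} [Category.{v} C] (e : Type v ≌ C) :
    IsElementaryTopos C where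
  hasFiniteLimits := ⟨fun _ _ _ => Adjunction.hasLimitsOfShape_of_equivalence e.inverse⟩
  cartesianClosed :=
    have : HasFiniteProducts C :=
      ⟨fun _ => Adjunction.hasLimitsOfShape_of_equivalence e.inverse⟩
    letI : CartesianMonoidalCategory C := .ofHasFiniteProducts
    ⟨inferInstance, ⟨cartesianClosedOfEquiv e⟩⟩
  -- The classifier is transported from sheaves on the point.
  hasSubobjectClassifier :=
    ⟨HasSubobjectClassifier.exists_classifier.map fun c => c.ofEquivalence
      (sheafPointEquivalence.trans e)⟩

theorem isGrothendieckTopos_of_equivalence {C : Type u} [Category.{v} C] (e : Type v ≌ C) :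
    IsGrothendieckTopos C :=
  ⟨Discrete PUnit, inferInstance, ⊥, ⟨(sheafPointEquivalence.trans e).symm⟩⟩

theorem balanced_of_reflectsIsomorphisms {C D : Type*} [Category* C] [Category* D] [Balanced D]
    (F : C ⥤ D) [F.ReflectsIsomorphisms] [F.PreservesMonomorphisms] [F.PreservesEpimorphisms] :
    Balanced C where
  isIso_of_mono_of_epi f _ _ :=
    have := isIso_of_mono_of_epi (F.map f)
    isIso_of_reflects_iso f F

/-- With a subobject classifier every mono is an equalizer, and an epic equalizer is invertible. -/
theorem IsElementaryTopos.balanced {C : Type u} [Category.{v} C] (h : IsElementaryTopos C) :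
    Balanced C :=
  have := h.hasSubobjectClassifier
  inferInstance

theorem IsGrothendieckTopos.balanced {C : Type u} [Category.{v} C] (h : IsGrothendieckTopos C) :
    Balanced C :=
  have ⟨_, _, _, ⟨e⟩⟩ := h
  balanced_of_reflectsIsomorphisms e.functor

end Topos

/-! ### The equivalences, with fullness of `Γ` as the hub -/

theorem mainTheorem6 (A : Type u) [ImplicativeAlgebra A] :
    List.TFAE
      [Balanced (ImplicativeAlgebra.Assembly A),
        IsElementaryTopos (ImplicativeAlgebra.Assembly A),
        IsGrothendieckTopos (ImplicativeAlgebra.Assembly A),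
        (ImplicativeAlgebra.Assembly.forgetful A).Full,
        IsIso (ImplicativeAlgebra.Assembly.adj A).unit ∧
          IsIso (ImplicativeAlgebra.Assembly.adj A).counit,
        ImplicativeAlgebra.IsForcing A] := by
  tfae_have 1 → 4 := fun _ => ImplicativeAlgebra.Assembly.full_forgetful_of_balanced
  tfae_have 4 → 5 := fun _ => ⟨inferInstance, inferInstance⟩
  tfae_have 5 → 4 := fun ⟨_, _⟩ =>
    (ImplicativeAlgebra.Assembly.adj A).fullyFaithfulLOfIsIsoUnit.full
  tfae_have 4 → 2 := fun _ =>
    isElementaryTopos_of_equivalence (ImplicativeAlgebra.Assembly.forgetful A).asEquivalence.symm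
  tfae_have 4 → 3 := fun _ =>
    isGrothendieckTopos_of_equivalence (ImplicativeAlgebra.Assembly.forgetful A).asEquivalence.symm
  tfae_have 2 → 1 := IsElementaryTopos.balanced
  tfae_have 3 → 1 := IsGrothendieckTopos.balanced
  tfae_have 4 → 6 := fun _ =>
    ImplicativeAlgebra.isForcing_of_principal ImplicativeAlgebra.Assembly.principal_of_full_forgetful
  tfae_have 6 → 4 := fun h =>
    ImplicativeAlgebra.Assembly.full_forgetful_of_principal
      (ImplicativeAlgebra.principal_of_isForcing h)
  tfae_finish
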